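/- Let $G=(V,E)$ be a finite simple undirected graph with $V\neq\emptyset$ and let $X\subseteq V$. Write $\mathit{MC}(G)$ and $\mathit{MS}(G)$ for the sets of maximal cliques and of maximal stable (independent) sets of $G$. Say that $G(X,1)$ holds if some $S\in\mathit{MC}(G)$ satisfies $S\subseteq X$, and that $G(X,0)$ holds if some $T\in\mathit{MS}(G)$ satisfies $T\cap X=\emptyset$. Call $G$ deterministic if for no $Y\subseteq V$ both $G(Y,0)$ and $G(Y,1)$ hold. A module of $G$ is a set $M\subseteq V$ all of whose elements have the same neighbours outside $M$. The decomposition tree $T(G)$ is defined by recursion: if $V=\{x\}$ it is the leaf $x$; if $G$ is disconnected, its root is labelled $\vee$ and its children are the trees of the connected components of $G$; if the complement $\overline G$ is disconnected, its root is labelled $\wedge$ and its children are the trees of the subgraphs of $G$ induced by the connected components of $\overline G$; otherwise, with $P$ the set of maximal proper modules of $G$, its root is a prime node labelled by the quotient graph $G/P$ (with vertex set $P$, where distinct $M,N\in P$ are adjacent iff all vertices of $M$ are adjacent in $G$ to all vertices of $N$) and its children are the trees of the subgraphs induced by the $M\in P$. The evaluation game is played from the root of $T(G)$. At a $\vee$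 node Eloise chooses a child, and at a $\wedge$ node Abelard chooses a child. At a prime node with quotient $Q$, Eloise chooses some $S\in\mathit{MC}(Q)$ and Abelard some $T\in\mathit{MS}(Q)$; play continues at the unique element of $S\cap T$ if there is one, and otherwise ends with outcome $\emptyset$ (a draw). A play that reaches a leaf $x$ has outcome $x$; Eloise wins it if $x\in X$, and Abelard wins it if $x\notin X$. A static strategy for Eloise assigns to each $\vee$ node of $T(G)$ a child and to each prime node a maximal clique of its quotient; a static strategy for Abelard assigns to each $\wedge$ node a child and to each prime node a maximal stable set of its quotient (in both cases independently of the opponent's moves). A strategy of a player is winning if that player wins every play consistent with it, and drawing if every play consistent with it is a win for that player or a draw. Then: 1. $G(X,1)$ holds if and only if Eloise has a static drawing strategy. 2. $G(X,0)$ holds if and only if Abelard has a static drawing strategy. 3. If $G$ is deterministic, then $G(X,1)$ holds if and only if Eloise has a static winning strategy, and $G(X,0)$ holds if and only if Abelard has a static winning strategy. -/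

import Mathlib

namespace BGL

universe u

/-! ### Evaluation of graphs -/

/-- `MC G`: the maximal cliques of `G`. -/
def MC {W : Type u} (G : SimpleGraph W) : Set (Set W) :=
  {S | Maximal (fun A : Set W => G.IsClique A) S}

/-- `MS G`: the maximal stable (independent) sets of `G`. -/
def MS {W : Type u} (G : SimpleGraph W) : Set (Set W) :=
  {T | Maximal (fun A : Set W => G.IsIndepSet A) T}

/-- `G(X,1)`. -/
def EvalsToOne {V : Type u} (G : SimpleGraph V) (X : Set V) : Prop :=
  ∃ S ∈ MC G, S ⊆ X

/-- `G(X,0)`. -/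
def EvalsToZero {V : Type u} (G : SimpleGraph V) (X : Set V) : Prop :=
  ∃ T ∈ MS G, X ∩ T = ∅

/-- `G` is deterministic: no assignment evaluates to both `0` and `1`. -/
def Deterministic {V : Type u} (G : SimpleGraph V) : Prop :=
  ∀ X : Set V, ¬ (EvalsToZero G X ∧ EvalsToOne G X)

/-! ### Modules and quotients -/

/-- `M` is a module of `G`: all elements of `M` have the same neighbourhood outside `M`. -/
def IsModule {W : Type u} (G : SimpleGraph W) (M : Set W) : Prop :=
  ∀ x ∈ M, ∀ y ∈ M, ∀ z, z ∉ M → (G.Adj x z ↔ G.Adj y z)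

/-- The vertex sets of the connected components of the induced subgraph `G ↾ M`,
as subsets of `V`. -/
def components {V : Type u} (G : SimpleGraph V) (M : Set V) : Set (Set V) :=
  {N | ∃ c : (G.induce M).ConnectedComponent, N = Subtype.val '' c.supp}

/-- The maximal proper modules of the induced subgraph `G ↾ M`, as subsets of `V`. -/
def maxProperModules {V : Type u} (G : SimpleGraph V) (M : Set V) : Set (Set V) :=
  {N | ∃ K : Set M,
    Maximal (fun A : Set M => IsModule (G.induce M) A ∧ A ≠ Set.univ) K ∧
      N = Subtype.val '' K}

/-- The quotient graph on a set `P` of modules: `M` and `N` are adjacent if every vertex of `M`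
is adjacent in `G` to every vertex of `N`. -/
def quotientGraph {V : Type u} (G : SimpleGraph V) (P : Set (Set V)) : SimpleGraph P where
  Adj M N := M ≠ N ∧ ∀ x ∈ M.1, ∀ y ∈ N.1, G.Adj x y
  symm := ⟨fun _ _ h => ⟨h.1.symm, fun x hx y hy => (h.2 y hy x hx).symm⟩⟩
  loopless := ⟨fun _ h => h.1 rfl⟩

theorem components_ssubset {V : Type u} {G : SimpleGraph V} {M N : Set V}
    (hM : ¬ (G.induce M).Connected) (hN : N ∈ components G M) : N ⊂ M := by
  obtain ⟨c, rfl⟩ := hN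
  refine ⟨by rintro _ ⟨x, -, rfl⟩; exact x.2, fun hsub => hM ?_⟩
  have hall : ∀ x : M, x ∈ c.supp := by
    intro x
    obtain ⟨y, hy, hyx⟩ := hsub x.2
    rwa [← Subtype.ext hyx]
  obtain ⟨v, hv⟩ := c.nonempty_supp
  have : Nonempty M := ⟨v⟩
  refine SimpleGraph.Connected.mk fun x y => ?_
  exact SimpleGraph.ConnectedComponent.exact ((hall x).trans (hall y).symm)

theorem maxProperModules_ssubset {V : Type u} {G : SimpleGraph V} {M N : Set V}
    (hN : N ∈ maxProperModules G M) : N ⊂ M := by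
  obtain ⟨K, hK, rfl⟩ := hN
  refine ⟨by rintro _ ⟨x, -, rfl⟩; exact x.2, fun hsub => hK.prop.2 ?_⟩
  refine Set.eq_univ_of_forall fun x => ?_
  obtain ⟨y, hy, hyx⟩ := hsub x.2
  rwa [← Subtype.ext hyx]

/-! ### Decomposition trees -/

/-- Trees whose leaves are vertices and whose internal nodes are labelled by `∨`, by `∧`, or by a
graph on the set of children. The children of a node are indexed by a set of subsets of `V`. -/
inductive DecTree (V : Type u) : Type u
  | leaf (x : V) : DecTree V
  | or (P : Set (Set V)) (child : P → DecTree V) : DecTree V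
  | and (P : Set (Set V)) (child : P → DecTree V) : DecTree V
  | prime (P : Set (Set V)) (Q : SimpleGraph P) (child : P → DecTree V) : DecTree V

open Classical in
/-- The decomposition tree of the induced subgraph `G ↾ M`.
Here `Gᶜ ↾ M` is the complement of `G ↾ M`. -/
noncomputable def decTreeOn {V : Type u} [Finite V] (G : SimpleGraph V) (M : Set V) :
    DecTree V :=
  if h : ∃ x, M = {x} then
    .leaf h.choose
  else if _hd : ¬ (G.induce M).Connected then
    .or (components G M) fun N => decTreeOn G N.1
  else if _hc : ¬ (Gᶜ.induce M).Connected then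
    .and (components Gᶜ M) fun N => decTreeOn G N.1
  else
    .prime (maxProperModules G M) (quotientGraph G (maxProperModules G M))
      fun N => decTreeOn G N.1
termination_by M.ncard
decreasing_by
  · exact Set.ncard_lt_ncard (components_ssubset _hd N.2) (Set.toFinite M)
  · exact Set.ncard_lt_ncard (components_ssubset _hc N.2) (Set.toFinite M)
  · exact Set.ncard_lt_ncard (maxProperModules_ssubset N.2) (Set.toFinite M)

/-- The (modular) decomposition tree of `G`. -/
noncomputable def decTree {V : Type u} [Finite V] (G : SimpleGraph V) : DecTree V :=
  decTreeOn G Set.univ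

/-! ### The evaluation game -/

/-- The plays of the game on a tree. At a `∨` node Eloise chooses a child, at a `∧` node Abelard
does. At a prime node Eloise chooses a maximal clique `S` and Abelard a maximal stable set `T`
of the quotient; the play ends in a deadlock if `S ∩ T = ∅` and otherwise continues on
the (unique) element of `S ∩ T`. -/
inductive Play {V : Type u} : DecTree V → Type u
  | leaf (x : V) : Play (.leaf x)
  | or {P : Set (Set V)} {child : P → DecTree V} (i : P) (p : Play (child i)) :
      Play (.or P child)
  | and {P : Set (Set V)} {child : P → DecTree V} (i : P) (p : Play (child i)) :
      Play (.and P child)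
  | deadlock {P : Set (Set V)} {Q : SimpleGraph P} {child : P → DecTree V}
      (S : MC Q) (T : MS Q) (h : S.1 ∩ T.1 = ∅) : Play (.prime P Q child)
  | prime {P : Set (Set V)} {Q : SimpleGraph P} {child : P → DecTree V}
      (S : MC Q) (T : MS Q) (i : P) (h : i ∈ S.1 ∩ T.1) (p : Play (child i)) :
      Play (.prime P Q child)

/-- The outcome of a play: a vertex, or `none` in the case of a deadlock. -/
def Play.outcome {V : Type u} : {t : DecTree V} → Play t → Option V
  | _, .leaf x => some x
  | _, .or _ p => p.outcome
  | _, .and _ p => p.outcome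
  | _, .deadlock _ _ _ => none
  | _, .prime _ _ _ _ p => p.outcome

/-- Eloise wins the play with respect to the assignment `X`. -/
def Play.EloiseWins {V : Type u} {t : DecTree V} (p : Play t) (X : Set V) : Prop :=
  ∃ x ∈ X, p.outcome = some x

/-- Abelard wins the play with respect to the assignment `X`. -/
def Play.AbelardWins {V : Type u} {t : DecTree V} (p : Play t) (X : Set V) : Prop :=
  ∃ x ∉ X, p.outcome = some x

/-- The play is a draw. -/
def Play.IsDraw {V : Type u} {t : DecTree V} (p : Play t) : Prop :=
  p.outcome = none

/-- Static strategies for Eloise: a choice of a child at each `∨` node of the tree and of a maximal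
clique of the quotient at each prime node, independent of the moves of Abelard. -/
def EloiseStrategy {V : Type u} : DecTree V → Type u
  | .leaf _ => PUnit
  | .or P child => P × ((i : P) → EloiseStrategy (child i))
  | .and P child => (i : P) → EloiseStrategy (child i)
  | .prime P Q child => MC Q × ((i : P) → EloiseStrategy (child i))

/-- Static strategies for Abelard: a choice of a child at each `∧` node of the tree and of a maximal
stable set of the quotient at each prime node, independent of the moves of Eloise. -/
def AbelardStrategy {V : Type u} : DecTree V → Type u
  | .leaf _ => PUnit
  | .or P child => (i : P) → AbelardStrategy (child i)
  | .and P child => P × ((i : P) → AbelardStrategy (child i))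
  | .prime P Q child => MS Q × ((i : P) → AbelardStrategy (child i))

/-- In the play, Eloise moves according to her strategy (and Abelard moves arbitrarily). -/
def Play.FollowsEloise {V : Type u} : {t : DecTree V} → Play t → EloiseStrategy t → Prop
  | _, .leaf _, _ => True
  | _, .or i p, σ => i = σ.1 ∧ p.FollowsEloise (σ.2 i)
  | _, .and i p, σ => p.FollowsEloise (σ i)
  | _, .deadlock S _ _, σ => S = σ.1
  | _, .prime S _ i _ p, σ => S = σ.1 ∧ p.FollowsEloise (σ.2 i)

/-- In the play, Abelard moves according to his strategy (and Eloise moves arbitrarily). -/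
def Play.FollowsAbelard {V : Type u} : {t : DecTree V} → Play t → AbelardStrategy t → Prop
  | _, .leaf _, _ => True
  | _, .or i p, τ => p.FollowsAbelard (τ i)
  | _, .and i p, τ => i = τ.1 ∧ p.FollowsAbelard (τ.2 i)
  | _, .deadlock _ T _, τ => T = τ.1
  | _, .prime _ T i _ p, τ => T = τ.1 ∧ p.FollowsAbelard (τ.2 i)

/-- Every play according to `σ` is a win for Eloise. -/
def EloiseStrategy.IsWinning {V : Type u} {t : DecTree V} (σ : EloiseStrategy t)
    (X : Set V) : Prop :=
  ∀ p : Play t, p.FollowsEloise σ → p.EloiseWins X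

/-- Every play according to `σ` is a win for Eloise or a draw. -/
def EloiseStrategy.IsDrawing {V : Type u} {t : DecTree V} (σ : EloiseStrategy t)
    (X : Set V) : Prop :=
  ∀ p : Play t, p.FollowsEloise σ → p.EloiseWins X ∨ p.IsDraw

/-- Every play according to `τ` is a win for Abelard. -/
def AbelardStrategy.IsWinning {V : Type u} {t : DecTree V} (τ : AbelardStrategy t)
    (X : Set V) : Prop :=
  ∀ p : Play t, p.FollowsAbelard τ → p.AbelardWins X

/-- Every play according to `τ` is a win for Abelard or a draw. -/
def AbelardStrategy.IsDrawing {V : Type u} {t : DecTree V} (τ : AbelardStrategy t)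
    (X : Set V) : Prop :=
  ∀ p : Play t, p.FollowsAbelard τ → p.AbelardWins X ∨ p.IsDraw

end BGL

/-! Every internal node of the tree stands for a vertex set `M` split into modules `P`, and a
maximal clique of `G ↾ M` is the same thing as a maximal clique `C` of the quotient together with a
maximal clique inside each part belonging to `C` (`iUnion_mem_MCOn`, `trace_mem_MC`,
`inter_mem_MCOn`). Hence `M` evaluates to one iff some such `C` has all its parts evaluating to one.
At `∨` nodes the quotient is `⊥`, so `C` is a single child; at `∧` nodes it is `⊤`, so `C` consists
of all children.

Drawing strategies obey the same recursion: once Eloise has fixed `C`, Abelard can steer to any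
child in `C`, since each vertex of the quotient lies in a maximal stable set, and missing `C` only
gives a draw. Induction along the tree yields the first claim. The second is its dual, because a
modular partition of `G` is one of `Gᶜ`, with complemented quotient.

For the third, determinism says that maximal cliques meet maximal stable sets. This passes to
quotients and to parts, so deadlocks never occur and drawing strategies are winning.

That maximal proper modules form a partition at prime nodes is `IsModule.eq_of_maximal`. -/

namespace BGL

universe u

variable {V : Type u}

/-! ### Maximal cliques relative to a set of vertices -/

/-- The maximal cliques of the induced subgraph `G ↾ M`, as subsets of `V`. -/
def MCOn (G : SimpleGraph V) (M : Set V) : Set (Set V) :=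
  {S | Maximal (fun A : Set V => A ⊆ M ∧ G.IsClique A) S}

theorem mem_MCOn_iff {G : SimpleGraph V} {M S : Set V} :
    S ∈ MCOn G M ↔ S ⊆ M ∧ G.IsClique S ∧
      ∀ x ∈ M, (∀ s ∈ S, s ≠ x → G.Adj x s) → x ∈ S := by
  constructor
  · intro (h : Maximal (fun A : Set V => A ⊆ M ∧ G.IsClique A) S)
    refine ⟨h.prop.1, h.prop.2, fun x hx hadj => ?_⟩
    have hins : insert x S ⊆ M ∧ G.IsClique (insert x S) :=
      ⟨Set.insert_subset hx h.prop.1,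
        SimpleGraph.isClique_insert.2 ⟨h.prop.2, fun s hs hne => hadj s hs hne.symm⟩⟩
    exact h.le_of_ge hins (Set.subset_insert x S) (Set.mem_insert x S)
  · rintro ⟨hM, hc, hmax⟩
    refine ⟨⟨hM, hc⟩, fun A hA hSA a ha => ?_⟩
    exact hmax a (hA.1 ha) fun s hs hne => hA.2 ha (hSA hs) hne.symm

theorem MC_eq_MCOn_univ (G : SimpleGraph V) : MC G = MCOn G Set.univ := by
  simp [MC, MCOn]

theorem mem_MC_iff {G : SimpleGraph V} {S : Set V} :
    S ∈ MC G ↔ G.IsClique S ∧ ∀ x, (∀ s ∈ S, s ≠ x → G.Adj x s) → x ∈ S := by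
  simp [MC_eq_MCOn_univ, mem_MCOn_iff]

theorem MS_eq_MC_compl (G : SimpleGraph V) : MS G = MC Gᶜ := by
  simp [MS, MC]

theorem exists_mem_MCOn_superset [Finite V] {G : SimpleGraph V} {M A : Set V}
    (hM : A ⊆ M) (hA : G.IsClique A) : ∃ S ∈ MCOn G M, A ⊆ S := by
  obtain ⟨S, hAS, hS⟩ :=
    (Set.toFinite {B : Set V | B ⊆ M ∧ G.IsClique B}).exists_le_maximal ⟨hM, hA⟩
  exact ⟨S, hS, hAS⟩

theorem MCOn_nonempty [Finite V] (G : SimpleGraph V) (M : Set V) : (MCOn G M).Nonempty := by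
  obtain ⟨S, hS, -⟩ := exists_mem_MCOn_superset (G := G) (Set.empty_subset M) (by simp)
  exact ⟨S, hS⟩

theorem exists_mem_MC_of_mem [Finite V] (G : SimpleGraph V) (x : V) : ∃ S ∈ MC G, x ∈ S := by
  obtain ⟨S, hS, hx⟩ := exists_mem_MCOn_superset (G := G) (Set.subset_univ {x}) (by simp)
  exact ⟨S, MC_eq_MCOn_univ G ▸ hS, hx rfl⟩

theorem nonempty_of_mem_MCOn {G : SimpleGraph V} {M S : Set V} (hM : M.Nonempty)
    (hS : S ∈ MCOn G M) : S.Nonempty := by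
  obtain ⟨x, hx⟩ := hM
  by_contra h
  rw [Set.not_nonempty_iff_eq_empty] at h
  subst h
  exact (mem_MCOn_iff.1 hS).2.2 x hx (by simp)

/-- Without a vertex, the empty set would be the only maximal clique. -/
theorem MC_bot [Nonempty V] : MC (⊥ : SimpleGraph V) = {S | ∃ x, S = {x}} := by
  ext S
  constructor
  · intro hS
    obtain ⟨x, hx⟩ := nonempty_of_mem_MCOn Set.univ_nonempty (MC_eq_MCOn_univ _ ▸ hS)
    refine ⟨x, Set.eq_singleton_iff_unique_mem.2 ⟨hx, fun y hy => ?_⟩⟩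
    by_contra hne
    exact (mem_MC_iff.1 hS).1 hy hx hne
  · rintro ⟨x, rfl⟩
    refine mem_MC_iff.2 ⟨by simp, fun y hy => ?_⟩
    by_contra hne
    exact hy x rfl (Ne.symm hne)

theorem MC_top : MC (⊤ : SimpleGraph V) = {Set.univ} := by
  ext S
  constructor
  · intro hS
    exact Set.eq_univ_of_forall fun x => (mem_MC_iff.1 hS).2 x fun s _ hne => hne.symm
  · rintro rfl
    exact mem_MC_iff.2 ⟨fun x _ y _ hne => hne, fun x _ => trivial⟩

/-- The induced subgraph `G ↾ M` evaluates to one. -/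
def EvalsToOneOn (G : SimpleGraph V) (M X : Set V) : Prop :=
  ∃ S ∈ MCOn G M, S ⊆ X

theorem evalsToOne_iff {G : SimpleGraph V} {X : Set V} :
    EvalsToOne G X ↔ EvalsToOneOn G Set.univ X := by
  rw [EvalsToOne, MC_eq_MCOn_univ, EvalsToOneOn]

theorem evalsToZero_iff {G : SimpleGraph V} {X : Set V} :
    EvalsToZero G X ↔ EvalsToOneOn Gᶜ Set.univ Xᶜ := by
  rw [EvalsToZero, MS_eq_MC_compl, MC_eq_MCOn_univ, EvalsToOneOn]
  simp only [← Set.disjoint_iff_inter_eq_empty, Set.subset_compl_iff_disjoint_left]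

theorem evalsToOneOn_singleton {G : SimpleGraph V} {X : Set V} {x : V} :
    EvalsToOneOn G {x} X ↔ x ∈ X := by
  constructor
  · rintro ⟨S, hS, hSX⟩
    exact hSX ((mem_MCOn_iff.1 hS).2.2 x rfl fun s hs hne =>
      absurd ((mem_MCOn_iff.1 hS).1 hs) hne)
  · intro hx
    exact ⟨{x}, mem_MCOn_iff.2 ⟨subset_rfl, by simp, fun y hy _ => hy⟩, by simpa using hx⟩

/-- Every maximal clique of `G ↾ M` meets every maximal stable set of `G ↾ M`. -/
def DeterministicOn (G : SimpleGraph V) (M : Set V) : Prop :=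
  ∀ S ∈ MCOn G M, ∀ T ∈ MCOn Gᶜ M, (S ∩ T).Nonempty

theorem Deterministic.deterministicOn_univ {G : SimpleGraph V} (h : Deterministic G) :
    DeterministicOn G Set.univ := by
  intro S hS T hT
  by_contra hne
  rw [Set.not_nonempty_iff_eq_empty] at hne
  -- A maximal clique `S` missing `T` is itself an assignment with both values.
  refine h S ⟨⟨T, ?_, hne⟩, S, ?_, subset_rfl⟩
  · rwa [MS_eq_MC_compl, MC_eq_MCOn_univ]
  · rwa [MC_eq_MCOn_univ]

/-! ### Modular partitions -/

/-- `P` is a partition of `M` into modules of `G ↾ M`. -/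
structure IsModularPartition (G : SimpleGraph V) (M : Set V) (P : Set (Set V)) : Prop where
  subset : ∀ N ∈ P, N ⊆ M
  nonempty : ∀ N ∈ P, N.Nonempty
  cover : ∀ x ∈ M, ∃ N ∈ P, x ∈ N
  eq_of_mem : ∀ N ∈ P, ∀ N' ∈ P, ∀ x ∈ N, x ∈ N' → N = N'
  adj_iff : ∀ N ∈ P, ∀ N' ∈ P, N ≠ N' → ∀ x ∈ N, ∀ y ∈ N', ∀ x' ∈ N, ∀ y' ∈ N',
    G.Adj x y → G.Adj x' y'

namespace IsModularPartition

variable {G : SimpleGraph V} {M : Set V} {P : Set (Set V)}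

/-- This symmetry lets every clique statement below serve for stable sets as well. -/
theorem compl (h : IsModularPartition G M P) : IsModularPartition Gᶜ M P where
  subset := h.subset
  nonempty := h.nonempty
  cover := h.cover
  eq_of_mem := h.eq_of_mem
  adj_iff N hN N' hN' hne x hx y hy x' hx' y' hy' hadj := by
    rw [SimpleGraph.compl_adj] at hadj ⊢
    refine ⟨?_, fun hc => hadj.2 (h.adj_iff N hN N' hN' hne x' hx' y' hy' x hx y hy hc)⟩
    rintro rfl
    exact hne (h.eq_of_mem N hN N' hN' x' hx' hy')

theorem nonempty_coe (h : IsModularPartition G M P) (hM : M.Nonempty) : Nonempty P := by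
  obtain ⟨x, hx⟩ := hM
  obtain ⟨N, hN, -⟩ := h.cover x hx
  exact ⟨⟨N, hN⟩⟩

theorem ne_of_mem (h : IsModularPartition G M P) {N N' : P} (hne : N ≠ N') {x y : V}
    (hx : x ∈ N.1) (hy : y ∈ N'.1) : x ≠ y := by
  rintro rfl
  exact hne (Subtype.ext (h.eq_of_mem N N.2 N' N'.2 x hx hy))

theorem quotient_adj_of_adj (h : IsModularPartition G M P) {N N' : P} (hne : N ≠ N') {x y : V}
    (hx : x ∈ N.1) (hy : y ∈ N'.1) (hadj : G.Adj x y) : (quotientGraph G P).Adj N N' :=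
  ⟨hne, fun x' hx' y' hy' =>
    h.adj_iff N N.2 N' N'.2 (fun e => hne (Subtype.ext e)) x hx y hy x' hx' y' hy' hadj⟩

theorem quotientGraph_compl (h : IsModularPartition G M P) :
    quotientGraph Gᶜ P = (quotientGraph G P)ᶜ := by
  ext N N'
  obtain ⟨x, hx⟩ := h.nonempty N N.2
  obtain ⟨y, hy⟩ := h.nonempty N' N'.2
  rw [SimpleGraph.compl_adj]
  constructor
  · rintro ⟨hne, hall⟩
    exact ⟨hne, fun hc => (hall x hx y hy).2 (hc.2 x hx y hy)⟩
  · rintro ⟨hne, hn⟩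
    exact ⟨hne, fun x' hx' y' hy' => ⟨h.ne_of_mem hne hx' hy',
      fun hadj => hn (h.quotient_adj_of_adj hne hx' hy' hadj)⟩⟩

theorem MS_quotientGraph (h : IsModularPartition G M P) :
    MS (quotientGraph G P) = MC (quotientGraph Gᶜ P) := by
  rw [MS_eq_MC_compl, h.quotientGraph_compl]

theorem iUnion_mem_MCOn (h : IsModularPartition G M P) {C : Set P}
    (hC : C ∈ MC (quotientGraph G P)) {f : P → Set V} (hf : ∀ N ∈ C, f N ∈ MCOn G N.1) :
    (⋃ N ∈ C, f N) ∈ MCOn G M := by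
  obtain ⟨hclique, hmax⟩ := mem_MC_iff.1 hC
  have hsub : ∀ N ∈ C, f N ⊆ N.1 := fun N hN => (mem_MCOn_iff.1 (hf N hN)).1
  refine mem_MCOn_iff.2 ⟨?_, ?_, ?_⟩
  · exact Set.iUnion₂_subset fun N hN => (hsub N hN).trans (h.subset N N.2)
  · intro x hx y hy hne
    simp only [Set.mem_iUnion] at hx hy
    obtain ⟨N, hN, hx⟩ := hx
    obtain ⟨N', hN', hy⟩ := hy
    by_cases hNN : N = N'
    · subst hNN
      exact (mem_MCOn_iff.1 (hf N hN)).2.1 hx hy hne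
    · exact (hclique hN hN' hNN).2 x (hsub N hN hx) y (hsub N' hN' hy)
  · intro x hx hadj
    simp only [Set.mem_iUnion] at hadj ⊢
    obtain ⟨N, hN, hxN⟩ := h.cover x hx
    -- Each chosen clique is nonempty, so a vertex of `N` joined to the whole union makes `N`
    -- adjacent to every other part in `C`; maximality of `C` then applies.
    have hNC : (⟨N, hN⟩ : P) ∈ C := by
      refine hmax _ fun N' hN' hne => ?_
      obtain ⟨y, hy⟩ := nonempty_of_mem_MCOn (h.nonempty N' N'.2) (hf N' hN')
      have hyN' := hsub N' hN' hy
      exact h.quotient_adj_of_adj hne.symm hxN hyN'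
        (hadj y ⟨N', hN', hy⟩ (h.ne_of_mem hne hyN' hxN))
    exact ⟨⟨N, hN⟩, hNC, (mem_MCOn_iff.1 (hf _ hNC)).2.2 x hxN
      fun s hs hne => hadj s ⟨_, hNC, hs⟩ hne⟩

theorem trace_mem_MC (h : IsModularPartition G M P) {S : Set V} (hS : S ∈ MCOn G M) :
    {N : P | (S ∩ N.1).Nonempty} ∈ MC (quotientGraph G P) := by
  obtain ⟨-, hclique, hmax⟩ := mem_MCOn_iff.1 hS
  refine mem_MC_iff.2 ⟨?_, fun N hN => ?_⟩
  · rintro N ⟨x, hxS, hxN⟩ N' ⟨y, hyS, hyN⟩ hne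
    exact h.quotient_adj_of_adj hne hxN hyN (hclique hxS hyS (h.ne_of_mem hne hxN hyN))
  · by_contra hcon
    obtain ⟨x, hx⟩ := h.nonempty N N.2
    -- If `S` missed `N`, any vertex of `N` would be joined to all of `S`, hence already in `S`.
    refine hcon ⟨x, hmax x (h.subset N N.2 hx) fun s hs _ => ?_, hx⟩
    obtain ⟨N', hN', hsN'⟩ := h.cover s ((mem_MCOn_iff.1 hS).1 hs)
    have hmem : (⟨N', hN'⟩ : P) ∈ {N : P | (S ∩ N.1).Nonempty} := ⟨s, hs, hsN'⟩
    exact (hN _ hmem fun e => hcon (e ▸ hmem)).2 x hx s hsN'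

theorem inter_mem_MCOn (h : IsModularPartition G M P) {S : Set V} (hS : S ∈ MCOn G M) {N : P}
    (hN : (S ∩ N.1).Nonempty) : S ∩ N.1 ∈ MCOn G N.1 := by
  obtain ⟨hSM, hclique, hmax⟩ := mem_MCOn_iff.1 hS
  refine mem_MCOn_iff.2 ⟨Set.inter_subset_right, hclique.subset Set.inter_subset_left,
    fun x hx hadj => ⟨hmax x (h.subset N N.2 hx) fun s hs hne => ?_, hx⟩⟩
  obtain ⟨N', hN', hsN'⟩ := h.cover s (hSM hs)
  -- Only vertices of `S` inside `N` impose a condition: the other parts met by `S` are completely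
  -- joined to `N`.
  by_cases e : N = ⟨N', hN'⟩
  · exact hadj s ⟨hs, by rw [e]; exact hsN'⟩ hne
  · exact ((mem_MC_iff.1 (h.trace_mem_MC hS)).1 hN
      (show (⟨N', hN'⟩ : P) ∈ {N : P | (S ∩ N.1).Nonempty} from ⟨s, hs, hsN'⟩) e).2 x hx s hsN'

theorem evalsToOneOn_iff (h : IsModularPartition G M P) {X : Set V} :
    EvalsToOneOn G M X ↔ ∃ C ∈ MC (quotientGraph G P), ∀ N ∈ C, EvalsToOneOn G N.1 X := by
  constructor
  · rintro ⟨S, hS, hSX⟩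
    exact ⟨_, h.trace_mem_MC hS, fun N hN =>
      ⟨S ∩ N.1, h.inter_mem_MCOn hS hN, Set.inter_subset_left.trans hSX⟩⟩
  · rintro ⟨C, hC, hall⟩
    choose! f hf hfX using hall
    exact ⟨_, h.iUnion_mem_MCOn hC hf, Set.iUnion₂_subset hfX⟩

theorem evalsToOneOn_iff_exists (h : IsModularPartition G M P) (hM : M.Nonempty)
    (hQ : quotientGraph G P = ⊥) {X : Set V} :
    EvalsToOneOn G M X ↔ ∃ N : P, EvalsToOneOn G N.1 X := by
  have := h.nonempty_coe hM
  rw [h.evalsToOneOn_iff, hQ, MC_bot]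
  constructor
  · rintro ⟨_, ⟨N, rfl⟩, hN⟩
    exact ⟨N, hN N rfl⟩
  · rintro ⟨N, hN⟩
    exact ⟨_, ⟨N, rfl⟩, by rintro _ rfl; exact hN⟩

theorem evalsToOneOn_iff_forall (h : IsModularPartition G M P)
    (hQ : quotientGraph G P = ⊤) {X : Set V} :
    EvalsToOneOn G M X ↔ ∀ N : P, EvalsToOneOn G N.1 X := by
  rw [h.evalsToOneOn_iff, hQ, MC_top]
  simp

theorem quotientGraph_compl_eq_top (h : IsModularPartition G M P)
    (hQ : quotientGraph G P = ⊥) : quotientGraph Gᶜ P = ⊤ := by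
  rw [h.quotientGraph_compl, hQ, compl_bot]

theorem quotientGraph_compl_eq_bot (h : IsModularPartition G M P)
    (hQ : quotientGraph G P = ⊤) : quotientGraph Gᶜ P = ⊥ := by
  rw [h.quotientGraph_compl, hQ, compl_top]

/-- Glue the local cliques and the local stable sets into global ones. These meet, and disjointness
of the parts puts the common vertex in a part used by both. -/
theorem exists_common_of_deterministicOn (h : IsModularPartition G M P)
    (hdet : DeterministicOn G M) {C D : Set P} (hC : C ∈ MC (quotientGraph G P))
    (hD : D ∈ MS (quotientGraph G P)) {f g : P → Set V} (hf : ∀ N ∈ C, f N ∈ MCOn G N.1)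
    (hg : ∀ N ∈ D, g N ∈ MCOn Gᶜ N.1) : ∃ N ∈ C ∩ D, (f N ∩ g N).Nonempty := by
  rw [h.MS_quotientGraph] at hD
  obtain ⟨x, hx, hy⟩ := hdet _ (h.iUnion_mem_MCOn hC hf) _ (h.compl.iUnion_mem_MCOn hD hg)
  simp only [Set.mem_iUnion] at hx hy
  obtain ⟨N, hN, hx⟩ := hx
  obtain ⟨N', hN', hy⟩ := hy
  have e : N = N' := by
    by_contra hne
    exact h.ne_of_mem hne ((mem_MCOn_iff.1 (hf N hN)).1 hx)
      ((mem_MCOn_iff.1 (hg N' hN')).1 hy) rfl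
  subst e
  exact ⟨N, ⟨hN, hN'⟩, x, hx, hy⟩

theorem inter_nonempty_of_deterministicOn [Finite V] (h : IsModularPartition G M P)
    (hdet : DeterministicOn G M) {C D : Set P} (hC : C ∈ MC (quotientGraph G P))
    (hD : D ∈ MS (quotientGraph G P)) : (C ∩ D).Nonempty := by
  choose f hf using fun N : P => MCOn_nonempty G N.1
  choose g hg using fun N : P => MCOn_nonempty Gᶜ N.1
  obtain ⟨N, hN, -⟩ := h.exists_common_of_deterministicOn hdet hC hD (fun N _ => hf N)
    fun N _ => hg N
  exact ⟨N, hN⟩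

/-- Extend `S` and `T` to all of `M`, using a maximal clique and a maximal stable set of the
quotient that both pass through `N`. These two share no other part, so the common vertex lies in `S
∩ T`. -/
theorem deterministicOn_of_mem [Finite V] (h : IsModularPartition G M P)
    (hdet : DeterministicOn G M) (N : P) : DeterministicOn G N.1 := by
  classical
  intro S hS T hT
  choose f hf using fun N : P => MCOn_nonempty G N.1
  choose g hg using fun N : P => MCOn_nonempty Gᶜ N.1
  obtain ⟨C, hC, hNC⟩ := exists_mem_MC_of_mem (quotientGraph G P) N
  obtain ⟨D, hD, hND⟩ := exists_mem_MC_of_mem (quotientGraph G P)ᶜ N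
  have hf' : ∀ K ∈ C, Function.update f N S K ∈ MCOn G K.1 := by
    intro K _
    by_cases e : K = N
    · subst e; simpa using hS
    · simpa [e] using hf K
  have hg' : ∀ K ∈ D, Function.update g N T K ∈ MCOn Gᶜ K.1 := by
    intro K _
    by_cases e : K = N
    · subst e; simpa using hT
    · simpa [e] using hg K
  obtain ⟨K, ⟨hKC, hKD⟩, hne⟩ := h.exists_common_of_deterministicOn hdet hC
    (by rwa [MS_eq_MC_compl]) hf' hg'
  have e : K = N := by
    by_contra hKN
    exact ((mem_MC_iff.1 hD).1 hKD hND hKN).2 ((mem_MC_iff.1 hC).1 hKC hNC hKN)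
  subst e
  simpa using hne

end IsModularPartition

/-! ### Connected components -/

theorem isModularPartition_components (G : SimpleGraph V) (M : Set V) :
    IsModularPartition G M (components G M) ∧ quotientGraph G (components G M) = ⊥ := by
  have hadj : ∀ N ∈ components G M, ∀ N' ∈ components G M, N ≠ N' → ∀ x ∈ N, ∀ y ∈ N',
      ¬ G.Adj x y := by
    rintro _ ⟨c, rfl⟩ _ ⟨d, rfl⟩ hne _ ⟨x, hx, rfl⟩ _ ⟨y, hy, rfl⟩ hadj
    apply hne
    have : (G.induce M).Adj x y := hadj
    have e := SimpleGraph.ConnectedComponent.connectedComponentMk_eq_of_adj this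
    rw [SimpleGraph.ConnectedComponent.mem_supp_iff] at hx hy
    rw [← hx, ← hy, e]
  have hpart : IsModularPartition G M (components G M) := by
    refine ⟨?_, ?_, ?_, ?_, ?_⟩
    · rintro _ ⟨c, rfl⟩ _ ⟨x, -, rfl⟩
      exact x.2
    · rintro _ ⟨c, rfl⟩
      exact c.nonempty_supp.image _
    · intro x hx
      exact ⟨_, ⟨(G.induce M).connectedComponentMk ⟨x, hx⟩, rfl⟩, ⟨x, hx⟩, rfl, rfl⟩
    · rintro _ ⟨c, rfl⟩ _ ⟨d, rfl⟩ _ ⟨x, hx, rfl⟩ ⟨y, hy, hyx⟩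
      obtain rfl := Subtype.ext hyx
      rw [SimpleGraph.ConnectedComponent.mem_supp_iff] at hx hy
      rw [← hx, ← hy]
    · exact fun N hN N' hN' hne x hx y hy _ _ _ _ hxy =>
        absurd hxy (hadj N hN N' hN' hne x hx y hy)
  refine ⟨hpart, ?_⟩
  ext N N'
  refine iff_of_false (fun hNN => ?_) (by simp)
  -- Nonemptiness matters: adjacency to an empty part would hold vacuously.
  obtain ⟨x, hx⟩ := hpart.nonempty N N.2
  obtain ⟨y, hy⟩ := hpart.nonempty N' N'.2
  exact hadj N N.2 N' N'.2 (fun e => hNN.1 (Subtype.ext e)) x hx y hy (hNN.2 x hx y hy)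

/-! ### Maximal proper modules -/

theorem not_connected_of_forall_not_adj {G : SimpleGraph V} {A : Set V} (hA : A.Nonempty)
    (hA' : A ≠ Set.univ) (h : ∀ x ∈ A, ∀ y ∉ A, ¬ G.Adj x y) : ¬ G.Connected := by
  intro hG
  obtain ⟨x, hx⟩ := hA
  obtain ⟨y, hy⟩ := (Set.ne_univ_iff_exists_notMem A).1 hA'
  obtain ⟨w⟩ := hG.preconnected x y
  obtain ⟨d, -, h₁, h₂⟩ := w.exists_boundary_dart A hx hy
  exact h _ h₁ _ h₂ d.adj

theorem IsModule.compl {G : SimpleGraph V} {A : Set V} (h : IsModule G A) : IsModule Gᶜ A := by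
  intro x hx y hy z hz
  have hxz : x ≠ z := by rintro rfl; exact hz hx
  have hyz : y ≠ z := by rintro rfl; exact hz hy
  simp [SimpleGraph.compl_adj, hxz, hyz, h x hx y hy z hz]

theorem isModule_singleton (G : SimpleGraph V) (x : V) : IsModule G {x} := by
  rintro _ rfl _ rfl z _
  rfl

theorem IsModule.union {G : SimpleGraph V} {A B : Set V} (hA : IsModule G A) (hB : IsModule G B)
    (h : (A ∩ B).Nonempty) : IsModule G (A ∪ B) := by
  obtain ⟨c, hcA, hcB⟩ := h
  have key : ∀ x ∈ A ∪ B, ∀ z, z ∉ A ∪ B → (G.Adj x z ↔ G.Adj c z) := by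
    rintro x (hx | hx) z hz
    · exact hA x hx c hcA z fun h => hz (Or.inl h)
    · exact hB x hx c hcB z fun h => hz (Or.inr h)
  exact fun x hx y hy z hz => (key x hx z hz).trans (key y hy z hz).symm

/-- If two proper modules overlap and cover the graph, and some edge joins their differences,
then the complement of the graph is disconnected. -/
theorem IsModule.not_connected_compl {G : SimpleGraph V} {A B : Set V} (hA : IsModule G A)
    (hB : IsModule G B) (hAB : A ∪ B = Set.univ) {x y : V} (hx : x ∉ B) (hy : y ∉ A)
    (hxy : G.Adj x y) : ¬ Gᶜ.Connected := by
  have hmemA : ∀ {z}, z ∉ B → z ∈ A := fun {z} hz =>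
    (hAB ▸ Set.mem_univ z : z ∈ A ∪ B).resolve_right hz
  have hmemB : ∀ {z}, z ∉ A → z ∈ B := fun {z} hz =>
    (hAB ▸ Set.mem_univ z : z ∈ A ∪ B).resolve_left hz
  refine not_connected_of_forall_not_adj ⟨y, hmemB hy⟩
    ((Set.ne_univ_iff_exists_notMem B).2 ⟨x, hx⟩) fun b hb a ha hc => hc.2 ?_
  -- The edge spreads in two moves: `A` carries `x` to `a`, then `B` carries `y` to `b`. So
  -- everything outside `B` is joined to all of `B`.
  have hay : G.Adj a y := (hA x (hmemA hx) a (hmemA ha) y hy).1 hxy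
  exact (hB y (hmemB hy) b hb a ha).1 hay.symm

/-- Overlapping modules have a module as union. If it is proper, maximality makes both equal to it.
If it is everything, a pair from the two differences is an edge or a non-edge, which disconnects
`Gᶜ` or `G` respectively. -/
theorem IsModule.eq_of_maximal {G : SimpleGraph V} (hG : G.Connected) (hG' : Gᶜ.Connected)
    {A B : Set V} (hA : Maximal (fun K : Set V => IsModule G K ∧ K ≠ Set.univ) A)
    (hB : Maximal (fun K : Set V => IsModule G K ∧ K ≠ Set.univ) B)
    (h : (A ∩ B).Nonempty) : A = B := by
  by_cases hAB : A ∪ B = Set.univ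
  · exfalso
    obtain ⟨y, hy⟩ := (Set.ne_univ_iff_exists_notMem A).1 hA.prop.2
    obtain ⟨x, hx⟩ := (Set.ne_univ_iff_exists_notMem B).1 hB.prop.2
    by_cases hxy : G.Adj x y
    · exact hA.prop.1.not_connected_compl hB.prop.1 hAB hx hy hxy hG'
    · have hne : x ≠ y := by
        rintro rfl
        exact (hAB ▸ Set.mem_univ x : x ∈ A ∪ B).elim hy hx
      exact hA.prop.1.compl.not_connected_compl hB.prop.1.compl hAB hx hy ⟨hne, hxy⟩
        (by rwa [compl_compl])
  · have hU := And.intro (hA.prop.1.union hB.prop.1 h) hAB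
    exact (hA.eq_of_subset hU Set.subset_union_left).trans
      (hB.eq_of_subset hU Set.subset_union_right).symm

theorem isModularPartition_maxProperModules [Finite V] {G : SimpleGraph V} {M : Set V}
    (hM : ¬ ∃ x, M = {x}) (hG : (G.induce M).Connected) (hG' : (Gᶜ.induce M).Connected) :
    IsModularPartition G M (maxProperModules G M) := by
  have hc : Gᶜ.induce M = (G.induce M)ᶜ := by
    ext x y
    simp [SimpleGraph.compl_adj, Subtype.ext_iff]
  rw [hc] at hG'
  have hsing : ∀ x : M, ∃ K, Maximal
      (fun A : Set M => IsModule (G.induce M) A ∧ A ≠ Set.univ) K ∧ x ∈ K := by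
    intro x
    have hx : ({x} : Set M) ≠ Set.univ := by
      intro e
      refine hM ⟨x, Set.eq_singleton_iff_unique_mem.2 ⟨x.2, fun y hy => ?_⟩⟩
      have : (⟨y, hy⟩ : M) ∈ ({x} : Set M) := e ▸ Set.mem_univ _
      exact congrArg Subtype.val this
    obtain ⟨K, hxK, hK⟩ :=
      (Set.toFinite {A : Set M | IsModule (G.induce M) A ∧ A ≠ Set.univ}).exists_le_maximal
        ⟨isModule_singleton _ x, hx⟩
    exact ⟨K, hK, hxK rfl⟩
  have heq : ∀ N ∈ maxProperModules G M, ∀ N' ∈ maxProperModules G M, ∀ x ∈ N, x ∈ N' →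
      N = N' := by
    rintro _ ⟨K, hK, rfl⟩ _ ⟨L, hL, rfl⟩ _ ⟨x, hx, rfl⟩ ⟨y, hy, hyx⟩
    obtain rfl := Subtype.ext hyx
    rw [IsModule.eq_of_maximal hG hG' hK hL ⟨y, hx, hy⟩]
  refine ⟨fun N hN => (maxProperModules_ssubset hN).1, ?_, ?_, heq, ?_⟩
  · rintro _ ⟨K, hK, rfl⟩
    refine Set.Nonempty.image _ ?_
    by_contra hne
    -- The empty set is a proper module too, but it lies strictly inside a maximal one through any
    -- vertex.
    obtain ⟨x⟩ := hG.nonempty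
    obtain ⟨L, hL, hxL⟩ := hsing x
    rw [Set.not_nonempty_iff_eq_empty] at hne
    exact hne.subset (hK.le_of_ge hL.prop (hne ▸ Set.empty_subset L) hxL)
  · intro x hx
    obtain ⟨K, hK, hxK⟩ := hsing ⟨x, hx⟩
    exact ⟨_, ⟨K, hK, rfl⟩, ⟨x, hx⟩, hxK, rfl⟩
  · intro N hN N' hN' hne x hx y hy x' hx' y' hy' hadj
    have hdisj : ∀ z ∈ N, z ∉ N' := fun z hz hz' => hne (heq N hN N' hN' z hz hz')
    obtain ⟨K, hK, rfl⟩ := hN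
    obtain ⟨L, hL, rfl⟩ := hN'
    obtain ⟨x, hx, rfl⟩ := hx
    obtain ⟨y, hy, rfl⟩ := hy
    obtain ⟨x', hx', rfl⟩ := hx'
    obtain ⟨y', hy', rfl⟩ := hy'
    have hyK : y ∉ K := fun h => hdisj y ⟨y, h, rfl⟩ ⟨y, hy, rfl⟩
    have hxL : x' ∉ L := fun h => hdisj x' ⟨x', hx', rfl⟩ ⟨x', h, rfl⟩
    have h₁ : (G.induce M).Adj x' y := (hK.prop.1 x hx x' hx' y hyK).1 hadj
    have h₂ : (G.induce M).Adj y' x' := (hL.prop.1 y hy y' hy' x' hxL).1 h₁.symm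
    exact h₂.symm

/-! ### Induction along the decomposition tree -/

/-- Only the modular partition and its quotient matter at a node, so this principle hides components
and maximal modules from the game arguments. -/
theorem decTreeOn_induction [Finite V] (G : SimpleGraph V) {motive : Set V → DecTree V → Prop}
    (leaf : ∀ x, motive {x} (.leaf x))
    (or : ∀ M P child, M.Nonempty → IsModularPartition G M P → quotientGraph G P = ⊥ →
      (∀ i : P, motive i.1 (child i)) → motive M (.or P child))
    (and : ∀ M P child, M.Nonempty → IsModularPartition G M P → quotientGraph G P = ⊤ →
      (∀ i : P, motive i.1 (child i)) → motive M (.and P child))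
    (prime : ∀ M P child, M.Nonempty → IsModularPartition G M P →
      (∀ i : P, motive i.1 (child i)) → motive M (.prime P (quotientGraph G P) child))
    (M : Set V) (hM : M.Nonempty) : motive M (decTreeOn G M) := by
  induction hn : M.ncard using Nat.strong_induction_on generalizing M with
  | _ n ih =>
    subst hn
    have hrec : ∀ N : Set V, N.Nonempty → N ⊂ M → motive N (decTreeOn G N) := fun N hN hNM =>
      ih _ (Set.ncard_lt_ncard hNM (Set.toFinite M)) N hN rfl
    rw [decTreeOn]
    by_cases h : ∃ x, M = {x}
    · rw [dif_pos h]
      have := h.choose_spec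
      generalize h.choose = x at this ⊢
      subst this
      exact leaf x
    rw [dif_neg h]
    by_cases hd : ¬ (G.induce M).Connected
    · rw [dif_pos hd]
      obtain ⟨hP, hQ⟩ := isModularPartition_components G M
      exact or _ _ _ hM hP hQ fun i => hrec _ (hP.nonempty i i.2) (components_ssubset hd i.2)
    rw [dif_neg hd]
    by_cases hc : ¬ (Gᶜ.induce M).Connected
    · rw [dif_pos hc]
      -- The `∧` case is the `∨` case for `Gᶜ`, transported back by complementing.
      obtain ⟨hP, hQ⟩ := isModularPartition_components Gᶜ M
      have hP' := hP.compl
      have hQ' := hP.quotientGraph_compl_eq_top hQ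
      rw [compl_compl] at hP' hQ'
      exact and _ _ _ hM hP' hQ' fun i => hrec _ (hP.nonempty i i.2) (components_ssubset hc i.2)
    rw [dif_neg hc]
    have hP := isModularPartition_maxProperModules h (not_not.1 hd) (not_not.1 hc)
    exact prime _ _ _ hM hP fun i => hrec _ (hP.nonempty i i.2) (maxProperModules_ssubset i.2)

/-! ### Drawing strategies -/

section Strategies

variable {P : Set (Set V)} {Q : SimpleGraph P} {child : P → DecTree V} {X : Set V}

theorem EloiseStrategy.isDrawing_leaf {x : V} (σ : EloiseStrategy (.leaf x)) :
    σ.IsDrawing X ↔ x ∈ X := by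
  constructor
  · intro h
    obtain ⟨y, hy, e⟩ | h := h (.leaf x) trivial
    · cases e
      exact hy
    · cases h
  · rintro hx ⟨⟩ -
    exact Or.inl ⟨x, hx, rfl⟩

theorem EloiseStrategy.isDrawing_or (σ : EloiseStrategy (.or P child)) :
    σ.IsDrawing X ↔ EloiseStrategy.IsDrawing (σ.2 σ.1) X := by
  constructor
  · intro h p hp
    exact h (.or σ.1 p) ⟨rfl, hp⟩
  · rintro h (_ | ⟨i, p⟩) ⟨rfl, hp⟩
    exact h p hp

theorem EloiseStrategy.isDrawing_and (σ : EloiseStrategy (.and P child)) :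
    σ.IsDrawing X ↔ ∀ i, EloiseStrategy.IsDrawing (σ i) X := by
  constructor
  · intro h i p hp
    exact h (.and i p) hp
  · rintro h (_ | _ | ⟨i, p⟩) hp
    exact h i p hp

theorem EloiseStrategy.isDrawing_prime [Finite V] (σ : EloiseStrategy (.prime P Q child)) :
    σ.IsDrawing X ↔ ∀ i ∈ σ.1.1, EloiseStrategy.IsDrawing (σ.2 i) X := by
  constructor
  · intro h i hi p hp
    -- Abelard can force any child `i` in Eloise's clique by playing a maximal stable set through
    -- `i`.
    obtain ⟨T, hT, hiT⟩ := exists_mem_MC_of_mem Qᶜ i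
    rw [← MS_eq_MC_compl] at hT
    exact h (.prime σ.1 ⟨T, hT⟩ i ⟨hi, hiT⟩ p) ⟨rfl, hp⟩
  · rintro h (_ | _ | _ | ⟨S, T, hST⟩ | ⟨S, T, i, hi, p⟩) hp
    · exact Or.inr rfl
    · obtain ⟨rfl, hp⟩ := hp
      exact h i hi.1 p hp

theorem AbelardStrategy.isDrawing_leaf {x : V} (τ : AbelardStrategy (.leaf x)) :
    τ.IsDrawing X ↔ x ∈ Xᶜ := by
  constructor
  · intro h
    obtain ⟨y, hy, e⟩ | h := h (.leaf x) trivial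
    · cases e
      exact hy
    · cases h
  · rintro hx ⟨⟩ -
    exact Or.inl ⟨x, hx, rfl⟩

theorem AbelardStrategy.isDrawing_or (τ : AbelardStrategy (.or P child)) :
    τ.IsDrawing X ↔ ∀ i, AbelardStrategy.IsDrawing (τ i) X := by
  constructor
  · intro h i p hp
    exact h (.or i p) hp
  · rintro h (_ | ⟨i, p⟩) hp
    exact h i p hp

theorem AbelardStrategy.isDrawing_and (τ : AbelardStrategy (.and P child)) :
    τ.IsDrawing X ↔ AbelardStrategy.IsDrawing (τ.2 τ.1) X := by
  constructor
  · intro h p hp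
    exact h (.and τ.1 p) ⟨rfl, hp⟩
  · rintro h (_ | _ | ⟨i, p⟩) ⟨rfl, hp⟩
    exact h p hp

theorem AbelardStrategy.isDrawing_prime [Finite V] (τ : AbelardStrategy (.prime P Q child)) :
    τ.IsDrawing X ↔ ∀ i ∈ τ.1.1, AbelardStrategy.IsDrawing (τ.2 i) X := by
  constructor
  · intro h i hi p hp
    obtain ⟨S, hS, hiS⟩ := exists_mem_MC_of_mem Q i
    exact h (.prime ⟨S, hS⟩ τ.1 i ⟨hiS, hi⟩ p) ⟨rfl, hp⟩
  · rintro h (_ | _ | _ | ⟨S, T, hST⟩ | ⟨S, T, i, hi, p⟩) hp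
    · exact Or.inr rfl
    · obtain ⟨rfl, hp⟩ := hp
      exact h i hi.2 p hp

end Strategies

/-- Choosing witnesses on a set of indices, and arbitrary elements elsewhere. -/
theorem exists_forall_mem_of_nonempty {ι : Type*} {α : ι → Type*} (hα : ∀ i, Nonempty (α i))
    {p : ∀ i, α i → Prop} {s : Set ι} (h : ∀ i ∈ s, ∃ a, p i a) :
    ∃ f : ∀ i, α i, ∀ i ∈ s, p i (f i) := by
  have : ∀ i, ∃ a, i ∈ s → p i a := by
    intro i
    by_cases hi : i ∈ s
    · obtain ⟨a, ha⟩ := h i hi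
      exact ⟨a, fun _ => ha⟩
    · obtain ⟨a⟩ := hα i
      exact ⟨a, fun h => absurd h hi⟩
  exact Classical.skolem.1 this

/-- `Nonempty` is carried through the induction because a static strategy must also prescribe moves
in subtrees that it never lets the play enter. -/
theorem evalsToOneOn_iff_exists_isDrawing [Finite V] (G : SimpleGraph V) (X : Set V) (M : Set V)
    (hM : M.Nonempty) :
    Nonempty (EloiseStrategy (decTreeOn G M)) ∧
      (EvalsToOneOn G M X ↔ ∃ σ : EloiseStrategy (decTreeOn G M), σ.IsDrawing X) := by
  refine decTreeOn_induction G (motive := fun M t => Nonempty (EloiseStrategy t) ∧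
    (EvalsToOneOn G M X ↔ ∃ σ : EloiseStrategy t, σ.IsDrawing X)) ?_ ?_ ?_ ?_ M hM
  · intro x
    have hne : Nonempty (EloiseStrategy (.leaf x)) := ⟨PUnit.unit⟩
    refine ⟨hne, ?_⟩
    simp only [EloiseStrategy.isDrawing_leaf, evalsToOneOn_singleton, exists_const]
  · intro M P child hM hP hQ ih
    obtain ⟨i₀⟩ := hP.nonempty_coe hM
    refine ⟨⟨(i₀, fun i => (ih i).1.some)⟩, ?_⟩
    rw [hP.evalsToOneOn_iff_exists hM hQ]
    constructor
    · rintro ⟨i, hi⟩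
      obtain ⟨f, hf⟩ := exists_forall_mem_of_nonempty (fun i => (ih i).1) (s := {i})
        (p := fun i σ => EloiseStrategy.IsDrawing σ X)
        (by rintro _ rfl; exact (ih _).2.1 hi)
      exact ⟨(i, f), (EloiseStrategy.isDrawing_or _).2 (hf i rfl)⟩
    · rintro ⟨σ, hσ⟩
      exact ⟨σ.1, (ih _).2.2 ⟨_, (EloiseStrategy.isDrawing_or σ).1 hσ⟩⟩
  · intro M P child hM hP hQ ih
    refine ⟨⟨fun i => (ih i).1.some⟩, ?_⟩
    rw [hP.evalsToOneOn_iff_forall hQ]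
    constructor
    · intro h
      choose f hf using fun i => (ih i).2.1 (h i)
      exact ⟨f, (EloiseStrategy.isDrawing_and _).2 hf⟩
    · rintro ⟨σ, hσ⟩ i
      exact (ih i).2.2 ⟨_, (EloiseStrategy.isDrawing_and σ).1 hσ i⟩
  · intro M P child hM hP ih
    obtain ⟨i₀⟩ := hP.nonempty_coe hM
    obtain ⟨C₀, hC₀, -⟩ := exists_mem_MC_of_mem (quotientGraph G P) i₀
    refine ⟨⟨(⟨C₀, hC₀⟩, fun i => (ih i).1.some)⟩, ?_⟩
    rw [hP.evalsToOneOn_iff]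
    constructor
    · rintro ⟨C, hC, h⟩
      obtain ⟨f, hf⟩ := exists_forall_mem_of_nonempty (fun i => (ih i).1) (s := C)
        (p := fun i σ => EloiseStrategy.IsDrawing σ X) fun i hi => (ih i).2.1 (h i hi)
      exact ⟨(⟨C, hC⟩, f), (EloiseStrategy.isDrawing_prime _).2 hf⟩
    · rintro ⟨σ, hσ⟩
      exact ⟨σ.1.1, σ.1.2, fun i hi =>
        (ih i).2.2 ⟨_, (EloiseStrategy.isDrawing_prime σ).1 hσ i hi⟩⟩

theorem evalsToOneOn_compl_iff_exists_isDrawing [Finite V] (G : SimpleGraph V) (X : Set V)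
    (M : Set V) (hM : M.Nonempty) :
    Nonempty (AbelardStrategy (decTreeOn G M)) ∧
      (EvalsToOneOn Gᶜ M Xᶜ ↔ ∃ τ : AbelardStrategy (decTreeOn G M), τ.IsDrawing X) := by
  refine decTreeOn_induction G (motive := fun M t => Nonempty (AbelardStrategy t) ∧
    (EvalsToOneOn Gᶜ M Xᶜ ↔ ∃ τ : AbelardStrategy t, τ.IsDrawing X)) ?_ ?_ ?_ ?_ M hM
  · intro x
    have hne : Nonempty (AbelardStrategy (.leaf x)) := ⟨PUnit.unit⟩
    refine ⟨hne, ?_⟩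
    simp only [AbelardStrategy.isDrawing_leaf, evalsToOneOn_singleton, exists_const]
  · intro M P child hM hP hQ ih
    refine ⟨⟨fun i => (ih i).1.some⟩, ?_⟩
    rw [hP.compl.evalsToOneOn_iff_forall (hP.quotientGraph_compl_eq_top hQ)]
    constructor
    · intro h
      choose f hf using fun i => (ih i).2.1 (h i)
      exact ⟨f, (AbelardStrategy.isDrawing_or _).2 hf⟩
    · rintro ⟨τ, hτ⟩ i
      exact (ih i).2.2 ⟨_, (AbelardStrategy.isDrawing_or τ).1 hτ i⟩
  · intro M P child hM hP hQ ih
    obtain ⟨i₀⟩ := hP.nonempty_coe hM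
    refine ⟨⟨(i₀, fun i => (ih i).1.some)⟩, ?_⟩
    rw [hP.compl.evalsToOneOn_iff_exists hM (hP.quotientGraph_compl_eq_bot hQ)]
    constructor
    · rintro ⟨i, hi⟩
      obtain ⟨f, hf⟩ := exists_forall_mem_of_nonempty (fun i => (ih i).1) (s := {i})
        (p := fun i τ => AbelardStrategy.IsDrawing τ X)
        (by rintro _ rfl; exact (ih _).2.1 hi)
      exact ⟨(i, f), (AbelardStrategy.isDrawing_and _).2 (hf i rfl)⟩
    · rintro ⟨τ, hτ⟩
      exact ⟨τ.1, (ih _).2.2 ⟨_, (AbelardStrategy.isDrawing_and τ).1 hτ⟩⟩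
  · intro M P child hM hP ih
    obtain ⟨i₀⟩ := hP.nonempty_coe hM
    obtain ⟨C₀, hC₀, -⟩ := exists_mem_MC_of_mem (quotientGraph Gᶜ P) i₀
    rw [← hP.MS_quotientGraph] at hC₀
    refine ⟨⟨(⟨C₀, hC₀⟩, fun i => (ih i).1.some)⟩, ?_⟩
    rw [hP.compl.evalsToOneOn_iff, ← hP.MS_quotientGraph]
    constructor
    · rintro ⟨C, hC, h⟩
      obtain ⟨f, hf⟩ := exists_forall_mem_of_nonempty (fun i => (ih i).1) (s := C)
        (p := fun i τ => AbelardStrategy.IsDrawing τ X) fun i hi => (ih i).2.1 (h i hi)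
      exact ⟨(⟨C, hC⟩, f), (AbelardStrategy.isDrawing_prime _).2 hf⟩
    · rintro ⟨τ, hτ⟩
      exact ⟨τ.1.1, τ.1.2, fun i hi =>
        (ih i).2.2 ⟨_, (AbelardStrategy.isDrawing_prime τ).1 hτ i hi⟩⟩

/-! ### Deterministic graphs -/

/-- A deadlock needs a disjoint maximal clique and maximal stable set in some quotient; determinism
descends the tree and excludes this at each prime node. -/
theorem not_isDraw_of_deterministicOn [Finite V] (G : SimpleGraph V) (M : Set V)
    (hM : M.Nonempty) : DeterministicOn G M → ∀ p : Play (decTreeOn G M), ¬ p.IsDraw := by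
  refine decTreeOn_induction G
    (motive := fun M t => DeterministicOn G M → ∀ p : Play t, ¬ p.IsDraw) ?_ ?_ ?_ ?_ M hM
  · rintro x - ⟨⟩ h
    cases h
  · rintro M P child - hP - ih hdet (_ | ⟨i, p⟩) h
    exact ih i (hP.deterministicOn_of_mem hdet i) p h
  · rintro M P child - hP - ih hdet (_ | _ | ⟨i, p⟩) h
    exact ih i (hP.deterministicOn_of_mem hdet i) p h
  · rintro M P child - hP ih hdet (_ | _ | _ | ⟨S, T, hST⟩ | ⟨S, T, i, hi, p⟩) h
    · exact (hP.inter_nonempty_of_deterministicOn hdet S.2 T.2).ne_empty hST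
    · exact ih i (hP.deterministicOn_of_mem hdet i) p h

theorem EloiseStrategy.isWinning_iff_isDrawing {t : DecTree V} (ht : ∀ p : Play t, ¬ p.IsDraw)
    (σ : EloiseStrategy t) {X : Set V} : σ.IsWinning X ↔ σ.IsDrawing X :=
  forall₂_congr fun p _ => (or_iff_left (ht p)).symm

theorem AbelardStrategy.isWinning_iff_isDrawing {t : DecTree V} (ht : ∀ p : Play t, ¬ p.IsDraw)
    (τ : AbelardStrategy t) {X : Set V} : τ.IsWinning X ↔ τ.IsDrawing X :=
  forall₂_congr fun p _ => (or_iff_left (ht p)).symm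

end BGL

theorem mainTheorem6 {V : Type*} [Finite V] [Nonempty V] (G : SimpleGraph V) (X : Set V) :
    (BGL.EvalsToOne G X ↔
      ∃ σ : BGL.EloiseStrategy (BGL.decTree G), BGL.EloiseStrategy.IsDrawing σ X) ∧
    (BGL.EvalsToZero G X ↔
      ∃ τ : BGL.AbelardStrategy (BGL.decTree G), BGL.AbelardStrategy.IsDrawing τ X) ∧
    (BGL.Deterministic G →
      (BGL.EvalsToOne G X ↔
        ∃ σ : BGL.EloiseStrategy (BGL.decTree G), BGL.EloiseStrategy.IsWinning σ X) ∧
      (BGL.EvalsToZero G X ↔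
        ∃ τ : BGL.AbelardStrategy (BGL.decTree G), BGL.AbelardStrategy.IsWinning τ X)) := by
  have h₁ : BGL.EvalsToOne G X ↔
      ∃ σ : BGL.EloiseStrategy (BGL.decTree G), BGL.EloiseStrategy.IsDrawing σ X :=
    BGL.evalsToOne_iff.trans
      (BGL.evalsToOneOn_iff_exists_isDrawing G X Set.univ Set.univ_nonempty).2
  have h₀ : BGL.EvalsToZero G X ↔
      ∃ τ : BGL.AbelardStrategy (BGL.decTree G), BGL.AbelardStrategy.IsDrawing τ X :=
    BGL.evalsToZero_iff.trans
      (BGL.evalsToOneOn_compl_iff_exists_isDrawing G X Set.univ Set.univ_nonempty).2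
  refine ⟨h₁, h₀, fun hdet => ?_⟩
  have hdraw : ∀ p : BGL.Play (BGL.decTree G), ¬ p.IsDraw :=
    BGL.not_isDraw_of_deterministicOn G Set.univ Set.univ_nonempty hdet.deterministicOn_univ
  simp only [BGL.EloiseStrategy.isWinning_iff_isDrawing hdraw,
    BGL.AbelardStrategy.isWinning_iff_isDrawing hdraw]
  exact ⟨h₁, h₀⟩
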